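/- **Proposition (A priori strong maximum principle).** Let $V$ be a real signed Radon measure on $\mathbb R^3$ (for instance $V=v\,dx$ with a real function $v\in L^1_{loc}$) that is locally in the Kato class: for every $y\in\mathbb R^3$ there is $R>0$ with $$\int_{B(y,R)}\frac{d|V|(x)}{|x-y|}<\infty .$$ Let $\mathcal K_0$ be the closure of $C_c^\infty(\mathbb R^3)$ in the norm $\|h\|_{\mathcal K}=\sup_{y\in\mathbb R^3}\int_{\mathbb R^3}\frac{|h(x)|}{|x-y|}\,dx$, and for $h\in\mathcal K_0$ put $(\Delta^{-1}h)(x)=-\frac1{4\pi}\int_{\mathbb R^3}\frac{h(y)}{|x-y|}\,dy$. Let $f:\mathbb R^3\to[0,\infty)$ lie in $(\Delta^{-1}\mathcal K_0)_{loc}$, i.e. every point of $\mathbb R^3$ has a neighbourhood on which $f$ coincides with $\Delta^{-1}h$ for some $h\in\mathcal K_0$ (so $f$ is continuous). Suppose that $f$ solves $$-\Delta f+Vf=g\ge 0,\qquad \liminf_{x\to\infty}f(x)\ge 0,$$ where $g$ is a non-negative Radon measure on $\mathbb R^3$ and the equation holds in the sense of distributions. If $f\not\equiv0$, then $f(x)>0$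 for every $x\in\mathbb R^3$. -/

import Mathlib

open MeasureTheory Filter Topology
open scoped ENNReal

namespace StrongMax

/-- Euclidean three-space. -/
abbrev E3 : Type := EuclideanSpace ℝ (Fin 3)

/-- Real-valued test functions on `ℝ³`: smooth with compact support. -/
def IsTest (φ : E3 → ℝ) : Prop :=
  ContDiff ℝ ((⊤ : ℕ∞) : WithTop ℕ∞) φ ∧ HasCompactSupport φ

/-- The global Kato norm `sup_y ∫ |h(x)| / |x - y| dx`, with values in `[0, ∞]`. -/
noncomputable def katoNorm (h : E3 → ℝ) : ℝ≥0∞ :=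
  ⨆ y : E3, ∫⁻ x, ‖h x‖ₑ / ‖x - y‖ₑ

/-- `𝒦₀`: the closure of the test functions in the global Kato norm. (The Kato norm dominates the
`L¹` norm on each ball, so limits of test functions are functions.) -/
def MemK0 (h : E3 → ℝ) : Prop :=
  AEStronglyMeasurable h volume ∧
    ∀ ε : ℝ≥0∞, 0 < ε → ∃ φ : E3 → ℝ, IsTest φ ∧ katoNorm (h - φ) ≤ ε

/-- The inverse Laplacian on `ℝ³`: `(Δ⁻¹ h)(x) = -(4π)⁻¹ ∫ h(y) / |x - y| dy`. -/
noncomputable def invLaplacian (h : E3 → ℝ) (x : E3) : ℝ :=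
  -(4 * Real.pi)⁻¹ * ∫ y, h y / ‖x - y‖

/-- `(Δ⁻¹ 𝒦₀)_loc`: near each point, `f` coincides with some `Δ⁻¹ h`, `h ∈ 𝒦₀`. -/
def MemInvLaplacianK0Loc (f : E3 → ℝ) : Prop :=
  ∀ y : E3, ∃ h : E3 → ℝ, MemK0 h ∧ ∀ᶠ x in 𝓝 y, f x = invLaplacian h x

/-- A real (signed) Radon measure on `ℝ³`, possibly of infinite total variation, given by its
Jordan decomposition `V = V⁺ - V⁻`. A real locally integrable function `v` is the case in which
`V⁺` and `V⁻` have the densities `max v 0` and `max (-v) 0` with respect to Lebesgue measure. -/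
structure Potential where
  /-- the positive part -/
  pos : Measure E3
  /-- the negative part -/
  neg : Measure E3
  finite_pos : IsLocallyFiniteMeasure pos
  finite_neg : IsLocallyFiniteMeasure neg
  singular : Measure.MutuallySingular pos neg

/-- The total variation measure `|V| = V⁺ + V⁻`. -/
noncomputable def Potential.abs (V : Potential) : Measure E3 :=
  V.pos + V.neg

/-- `∫ u dV` for the signed measure `V`. -/
noncomputable def Potential.integral (V : Potential) (u : E3 → ℝ) : ℝ :=
  ∫ x, u x ∂V.pos - ∫ x, u x ∂V.neg

/-- `V ∈ 𝒦_loc`: for each `y` there is `R > 0` with `∫_{B(y,R)} |x - y|⁻¹ d|V|(x) < ∞`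
(the integrand is `∞` at `x = y`). -/
def Potential.MemKLoc (V : Potential) : Prop :=
  ∀ y : E3, ∃ R : ℝ, 0 < R ∧ ∫⁻ x in Metric.ball y R, ‖x - y‖ₑ⁻¹ ∂V.abs < ∞

/-- `-Δf + V f = g` in the sense of distributions, for a continuous `f`
and a non-negative Radon measure `g`. -/
def IsDistribSolution (V : Potential) (f : E3 → ℝ) (g : Measure E3) : Prop :=
  ∀ φ : E3 → ℝ, IsTest φ →
    -(∫ x, f x * Laplacian.laplacian φ x) + V.integral (fun x => f x * φ x) =
      ∫ x, φ x ∂g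

/-- `f` solves the boundary-value problem `-Δf + V f = g ≥ 0`, `liminf_{x → ∞} f(x) ≥ 0`. Here `g`
is a non-negative Radon measure, which is the same as a non-negative distribution. -/
def SolvesBVP (V : Potential) (f : E3 → ℝ) (g : Measure E3) : Prop :=
  IsLocallyFiniteMeasure g ∧ IsDistribSolution V f g ∧
    0 ≤ liminf (fun x => (f x : EReal)) (cocompact E3)

end StrongMax

/-!
Dropping `V⁻ f` and `g` leaves `Δf ≤ μ f` with `μ = V⁺`. Let `w` be a mollification of `1 + N f`,
`N ≥ 0`. Since `Δw` is at most the mollification of `N f μ`, and `N f ≤ w` at the scale of a fine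
mollifier, `Δ(log w) ≤ Δw / w` is at most the mollification of `μ`, whatever `N` is. The average of
`u` over the ball of radius `t` about `y`, with the weight `(1 - |z|²)₊`, has the `t`-derivative
`t/4 ∫ (1 - |z|²)₊² Δu(y + t z) dz`, so the average of `log (1 + N f)` over a ball about `y` exceeds
a multiple of `log (1 + N f(y))` at most by a Kato integral of `μ` at `y` and a constant. If
`f(y) = 0`, letting `N → ∞` shows that `f` vanishes near `y`. Hence the zero set of `f` is open and
closed.
-/

namespace StrongMax

open Metric
open scoped Convolution ContDiff Laplacian

section Real

theorem hasDerivAt_max_zero_sq (s : ℝ) :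
    HasDerivAt (fun t : ℝ => max 0 t ^ 2) (2 * max 0 s) s := by
  have remainder_le (t : ℝ) :
      ‖max 0 t ^ 2 - max 0 s ^ 2 - (t - s) * (2 * max 0 s)‖ ≤ 1 * ‖‖t - s‖ ^ 2‖ := by
    rw [one_mul, norm_pow, norm_norm, Real.norm_eq_abs, Real.norm_eq_abs, sq_abs, abs_le]
    rcases max_cases 0 s with ⟨hs, h⟩ | ⟨hs, h⟩ <;>
      rcases max_cases 0 t with ⟨ht, h'⟩ | ⟨ht, h'⟩ <;>
      rw [hs, ht] <;> constructor <;> nlinarith [sq_nonneg (t - s)]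
  exact hasDerivAt_iff_isLittleO.2 ((Asymptotics.IsBigO.of_bound 1
    (Eventually.of_forall remainder_le)).trans_isLittleO
      (Asymptotics.isLittleO_pow_sub_sub s one_lt_two))

theorem abs_log_sub_log_le {s t : ℝ} (hs : 1 ≤ s) (ht : 1 ≤ t) :
    |Real.log s - Real.log t| ≤ |s - t| := by
  have key {s t : ℝ} (hs : 1 ≤ s) (ht : 1 ≤ t) : Real.log s - Real.log t ≤ |s - t| := by
    rw [← Real.log_div (by positivity) (by positivity)]
    refine (Real.log_le_sub_one_of_pos (by positivity)).trans ?_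
    rw [div_sub_one (by positivity)]
    exact (div_le_div_of_nonneg_right (le_abs_self _) (by positivity)).trans
      (div_le_self (abs_nonneg _) ht)
  exact abs_le.2 ⟨by linarith [key ht hs, abs_sub_comm s t], key hs ht⟩

theorem min_one_mul_log_one_add_le {N s : ℝ} (hN : 0 ≤ N) (hs : 0 ≤ s) :
    Real.log (1 + N) * min s 1 ≤ Real.log (1 + N * s) := by
  have hmin : 0 ≤ min s 1 := le_min hs zero_le_one
  rw [mul_comm, ← Real.log_rpow (by positivity)]
  refine Real.log_le_log (by positivity) ?_
  calc (1 + N) ^ min s 1 ≤ 1 + min s 1 * N :=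
        rpow_one_add_le_one_add_mul_self (by linarith) hmin (min_le_right _ _)
    _ ≤ 1 + N * s := by
      rw [mul_comm]
      gcongr
      exact min_le_left _ _

theorem lintegral_Ioi_inv_pow_le (n : ℕ) {a : ℝ} (ha : 0 ≤ a) :
    ∫⁻ t in Set.Ioi a, ENNReal.ofReal (t ^ (n + 2))⁻¹ ≤ (ENNReal.ofReal a)⁻¹ ^ (n + 1) := by
  rcases ha.eq_or_lt with rfl | ha
  · simp
  have hexp : -((n + 2 : ℕ) : ℝ) < -1 := by push_cast; linarith [n.cast_nonneg (α := ℝ)]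
  calc ∫⁻ t in Set.Ioi a, ENNReal.ofReal (t ^ (n + 2))⁻¹
      = ∫⁻ t in Set.Ioi a, ENNReal.ofReal (t ^ (-((n + 2 : ℕ) : ℝ))) :=
        setLIntegral_congr_fun measurableSet_Ioi fun t ht => by
          simp only [Real.rpow_neg (ha.trans ht).le, Real.rpow_natCast]
    _ = ENNReal.ofReal ((a ^ (n + 1))⁻¹ / (n + 1)) := by
        rw [← ofReal_integral_eq_lintegral_ofReal (integrableOn_Ioi_rpow_of_lt hexp ha)
          (ae_restrict_of_forall_mem measurableSet_Ioi fun t ht =>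
            Real.rpow_nonneg (ha.trans ht).le _), integral_Ioi_rpow_of_lt hexp ha]
        have hadd : -((n + 2 : ℕ) : ℝ) + 1 = -((n + 1 : ℕ) : ℝ) := by push_cast; ring
        rw [hadd, Real.rpow_neg ha.le, Real.rpow_natCast, div_neg, neg_div, neg_neg]
        push_cast
        rfl
    _ ≤ ENNReal.ofReal ((a ^ (n + 1))⁻¹) :=
        ENNReal.ofReal_le_ofReal (div_le_self (by positivity) (by simp))
    _ = (ENNReal.ofReal a)⁻¹ ^ (n + 1) := by
        rw [← inv_pow, ENNReal.ofReal_pow (by positivity), ENNReal.ofReal_inv_of_pos ha]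

end Real

section NormedSpace

variable {E : Type*} [NormedAddCommGroup E] [NormedSpace ℝ E]

theorem contDiff_fderiv_apply {n : WithTop ℕ∞} {u : E → ℝ} (hu : ContDiff ℝ (n + 1) u) (v : E) :
    ContDiff ℝ n fun x => fderiv ℝ u x v :=
  (hu.fderiv_right le_rfl).clm_apply contDiff_const

theorem hasCompactSupport_fderiv_apply {u : E → ℝ} (hu : HasCompactSupport u) (v : E) :
    HasCompactSupport fun x => fderiv ℝ u x v :=
  (hu.fderiv ℝ).comp_left (g := fun L : E →L[ℝ] ℝ => L v) (by simp)

theorem fderiv_comp_add_smul_apply (u : E → ℝ) (y : E) (t : ℝ) (z v : E) :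
    fderiv ℝ (fun z => u (y + t • z)) z v = t * fderiv ℝ u (y + t • z) v := by
  rw [fderiv_comp_smul (f := fun z => u (y + z)), fderiv_comp_add_left]
  rfl

theorem fderiv_log_apply {w : E → ℝ} {x : E} (hw : DifferentiableAt ℝ w x) (h0 : w x ≠ 0) (v : E) :
    fderiv ℝ (fun z => Real.log (w z)) x v = fderiv ℝ w x v / w x := by
  rw [(hw.hasFDerivAt.log h0).fderiv]
  simp [div_eq_inv_mul]

theorem add_smul_mem_closedBall {y z : E} {t : ℝ} (ht : 0 ≤ t) (hz : ‖z‖ ≤ 1) :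
    y + t • z ∈ closedBall y t := by
  simpa [norm_smul, abs_of_nonneg ht] using mul_le_of_le_one_right ht hz

theorem exists_contDiffBump_dist_le [FiniteDimensional ℝ E] {f : E → ℝ} (hf : Continuous f)
    (y : E) (r : ℝ) {η ε : ℝ} (hη : 0 < η) (hε : 0 < ε) :
    ∃ ρ : ContDiffBump (0 : E), ρ.rOut ≤ η ∧
      ∀ x ∈ closedBall y r, ∀ z ∈ ball x ρ.rOut, dist (f z) (f x) ≤ ε := by
  obtain ⟨δ, hδ, hδf⟩ := Metric.mem_uniformity_dist.1
    ((isCompact_closedBall y r).uniformContinuousAt_of_continuousAt f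
      (fun x _ => hf.continuousAt) (Metric.dist_mem_uniformity hε))
  have hmin : 0 < min δ η := lt_min hδ hη
  refine ⟨⟨min δ η / 2, min δ η, half_pos hmin, half_lt_self hmin⟩, min_le_right _ _,
    fun x hx z hz => ?_⟩
  rw [dist_comm]
  exact (hδf ((mem_ball'.1 hz).trans_le (min_le_left _ _)) hx).le

variable [MeasurableSpace E] [BorelSpace E] [FiniteDimensional ℝ E]

theorem integral_mul_fderiv_eq_neg {μ : Measure E} [μ.IsAddHaarMeasure] {u φ : E → ℝ}
    (hu : ContDiff ℝ 1 u) (hφ : ContDiff ℝ 1 φ) (hs : HasCompactSupport φ) (v : E) :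
    ∫ x, φ x * fderiv ℝ u x v ∂μ = -∫ x, fderiv ℝ φ x v * u x ∂μ := by
  have hu' := (contDiff_fderiv_apply (n := 0) hu v).continuous
  have hφ' := (contDiff_fderiv_apply (n := 0) hφ v).continuous
  exact integral_mul_fderiv_eq_neg_fderiv_mul_of_integrable
    ((hφ'.mul hu.continuous).integrable_of_hasCompactSupport
      (hasCompactSupport_fderiv_apply hs v).mul_right)
    ((hφ.continuous.mul hu').integrable_of_hasCompactSupport hs.mul_right)
    ((hφ.continuous.mul hu.continuous).integrable_of_hasCompactSupport hs.mul_right)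
    (fun x _ => hφ.differentiable (by norm_num) x) (fun x _ => hu.differentiable (by norm_num) x)

theorem fderiv_convolution_apply {μ : Measure E} [μ.IsAddHaarMeasure] {f ρ : E → ℝ}
    (hf : LocallyIntegrable f μ) (hρ : ContDiff ℝ 1 ρ) (hs : HasCompactSupport ρ) (x v : E) :
    fderiv ℝ (f ⋆[ContinuousLinearMap.mul ℝ ℝ, μ] ρ) x v =
      (f ⋆[ContinuousLinearMap.mul ℝ ℝ, μ] fun z => fderiv ℝ ρ z v) x := by
  rw [(hs.hasFDerivAt_convolution_right _ hf hρ x).fderiv,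
    convolution_precompR_apply _ hf (hs.fderiv ℝ) (hρ.continuous_fderiv (by norm_num))]

end NormedSpace

section InnerProductSpace

variable {E : Type*} [NormedAddCommGroup E] [InnerProductSpace ℝ E] [FiniteDimensional ℝ E]

theorem laplacian_eq_sum_fderiv_fderiv {ι : Type*} [Fintype ι] (b : OrthonormalBasis ι ℝ E)
    {u : E → ℝ} (hu : ContDiff ℝ 2 u) (x : E) :
    Δ u x = ∑ i, fderiv ℝ (fun z => fderiv ℝ u z (b i)) x (b i) := by
  have hu' : Differentiable ℝ (fderiv ℝ u) :=
    (hu.fderiv_right (m := 1) (by norm_num)).differentiable (by norm_num)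
  rw [InnerProductSpace.laplacian_eq_iteratedFDeriv_orthonormalBasis u b]
  refine Finset.sum_congr rfl fun i _ => ?_
  rw [iteratedFDeriv_two_apply, fderiv_clm_apply (hu' x) (differentiableAt_const _)]
  simp

theorem continuous_laplacian {u : E → ℝ} (hu : ContDiff ℝ 2 u) : Continuous (Δ u) := by
  rw [funext (laplacian_eq_sum_fderiv_fderiv (stdOrthonormalBasis ℝ E) hu)]
  exact continuous_finsetSum _ fun i _ => (contDiff_fderiv_apply (n := 0)
    (contDiff_fderiv_apply (n := 1) hu _) _).continuous

theorem laplacian_comp_add_smul {u : E → ℝ} (hu : ContDiff ℝ 2 u) (y : E) (t : ℝ) (z : E) :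
    Δ (fun z => u (y + t • z)) z = t ^ 2 * Δ u (y + t • z) := by
  let b := stdOrthonormalBasis ℝ E
  have hu' := fun i => contDiff_fderiv_apply (n := 1) hu (b i)
  rw [laplacian_eq_sum_fderiv_fderiv b (by fun_prop), laplacian_eq_sum_fderiv_fderiv b hu,
    Finset.mul_sum]
  refine Finset.sum_congr rfl fun i _ => ?_
  have hdiff : DifferentiableAt ℝ (fun z => fderiv ℝ u (y + t • z) (b i)) z :=
    ((hu' i).differentiable (by norm_num) _).comp z (by fun_prop)
  rw [funext fun z => fderiv_comp_add_smul_apply u y t z (b i), fderiv_const_mul hdiff,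
    smul_apply, smul_eq_mul, fderiv_comp_add_smul_apply (fun z => fderiv ℝ u z (b i)), sq,
    mul_assoc]

theorem laplacian_log_le {w : E → ℝ} (hw : ContDiff ℝ 2 w) (hpos : ∀ x, 0 < w x) (x : E) :
    Δ (fun z => Real.log (w z)) x ≤ Δ w x / w x := by
  let b := stdOrthonormalBasis ℝ E
  have hwd : Differentiable ℝ w := hw.differentiable (by norm_num)
  have hw' := fun i => contDiff_fderiv_apply (n := 1) hw (b i)
  have second_fderiv : ∀ i,
      fderiv ℝ (fun z => fderiv ℝ (fun z => Real.log (w z)) z (b i)) x (b i) =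
        fderiv ℝ (fun z => fderiv ℝ w z (b i)) x (b i) / w x - (fderiv ℝ w x (b i) / w x) ^ 2 := by
    intro i
    have hinv : HasFDerivAt (fun z => (w z)⁻¹) (-(w x ^ 2)⁻¹ • fderiv ℝ w x) x :=
      (hasDerivAt_inv (hpos x).ne').comp_hasFDerivAt x (hwd x).hasFDerivAt
    have hquot := ((hw' i).differentiable (by norm_num) x).hasFDerivAt.fun_mul hinv
    simp only [fun z => fderiv_log_apply (hwd z) (hpos z).ne' (b i), div_eq_mul_inv]
    rw [hquot.fderiv]
    simp only [add_apply, smul_apply, smul_eq_mul]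
    ring
  rw [laplacian_eq_sum_fderiv_fderiv b (hw.log fun z => (hpos z).ne'),
    laplacian_eq_sum_fderiv_fderiv b hw, Finset.sum_div]
  exact Finset.sum_le_sum fun i _ => (second_fderiv i).trans_le (sub_le_self _ (sq_nonneg _))

variable [MeasurableSpace E] [BorelSpace E]

theorem integral_mul_laplacian {u φ : E → ℝ} (hu : ContDiff ℝ 2 u) (hφ : ContDiff ℝ 1 φ)
    (hs : HasCompactSupport φ) {ι : Type*} [Fintype ι] (b : OrthonormalBasis ι ℝ E) :
    ∫ x, φ x * Δ u x = -∫ x, ∑ i, fderiv ℝ φ x (b i) * fderiv ℝ u x (b i) := by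
  have hu' := fun i => contDiff_fderiv_apply (n := 1) hu (b i)
  have hu'' := fun i => (contDiff_fderiv_apply (n := 0) (hu' i) (b i)).continuous
  have hφ' := fun i => (contDiff_fderiv_apply (n := 0) hφ (b i)).continuous
  simp only [laplacian_eq_sum_fderiv_fderiv b hu, Finset.mul_sum]
  rw [integral_finsetSum, integral_finsetSum, ← Finset.sum_neg_distrib]
  · exact Finset.sum_congr rfl fun i _ => integral_mul_fderiv_eq_neg (hu' i) hφ hs (b i)
  · exact fun i _ => ((hφ' i).mul (hu' i).continuous).integrable_of_hasCompactSupport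
      (hasCompactSupport_fderiv_apply hs (b i)).mul_right
  · exact fun i _ => (hφ.continuous.mul (hu'' i)).integrable_of_hasCompactSupport hs.mul_right

theorem laplacian_convolution {μ : Measure E} [μ.IsAddHaarMeasure] {f ρ : E → ℝ}
    (hf : LocallyIntegrable f μ) (hρ : ContDiff ℝ 2 ρ) (hs : HasCompactSupport ρ) (x : E) :
    Δ (f ⋆[ContinuousLinearMap.mul ℝ ℝ, μ] ρ) x = (f ⋆[ContinuousLinearMap.mul ℝ ℝ, μ] Δ ρ) x := by
  let b := stdOrthonormalBasis ℝ E
  have hρ' := fun i => contDiff_fderiv_apply (n := 1) hρ (b i)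
  have hs' := fun i => hasCompactSupport_fderiv_apply hs (b i)
  rw [laplacian_eq_sum_fderiv_fderiv b (hs.contDiff_convolution_right _ hf hρ),
    funext (laplacian_eq_sum_fderiv_fderiv b hρ)]
  simp_rw [convolution_def, map_sum]
  rw [integral_finsetSum]
  · refine Finset.sum_congr rfl fun i _ => ?_
    rw [funext fun z => fderiv_convolution_apply hf (hρ.of_le (by norm_num)) hs z (b i),
      fderiv_convolution_apply hf (hρ' i) (hs' i), convolution_def]
  · exact fun i _ => (hasCompactSupport_fderiv_apply (hs' i) (b i)).convolutionExists_right _ hf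
      (contDiff_fderiv_apply (n := 0) (hρ' i) (b i)).continuous x

end InnerProductSpace

section Bump

variable {E : Type*} [NormedAddCommGroup E]

/-- The weight `(1 - |z|²)₊` of the ball averages, chosen because the field `bump z • z` is the
gradient of `-bump ^ 2 / 4`. -/
noncomputable def bump (z : E) : ℝ := max 0 (1 - ‖z‖ ^ 2)

theorem bump_nonneg (z : E) : 0 ≤ bump z := le_max_left _ _

theorem bump_le_one (z : E) : bump z ≤ 1 := max_le zero_le_one (by simp)

theorem bump_pos {z : E} (hz : ‖z‖ < 1) : 0 < bump z :=
  lt_max_of_lt_right (by nlinarith [norm_nonneg z])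

theorem bump_eq_zero {z : E} (hz : 1 ≤ ‖z‖) : bump z = 0 :=
  max_eq_left (by nlinarith)

theorem continuous_bump : Continuous (bump : E → ℝ) := by
  unfold bump
  fun_prop

theorem hasCompactSupport_bump [ProperSpace E] : HasCompactSupport (bump : E → ℝ) :=
  HasCompactSupport.intro (isCompact_closedBall 0 1) fun z hz =>
    bump_eq_zero (by simpa using (lt_of_not_ge (by simpa using hz)).le)

variable [InnerProductSpace ℝ E]

theorem hasFDerivAt_bump_sq (z : E) :
    HasFDerivAt (fun z : E => bump z ^ 2) (-(4 * bump z) • innerSL ℝ z) z := by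
  refine ((hasDerivAt_max_zero_sq _).comp_hasFDerivAt z
    ((hasStrictFDerivAt_norm_sq z).hasFDerivAt.const_sub 1)).congr_fderiv ?_
  ext v
  simp only [bump, smul_apply, neg_apply, nsmul_eq_mul, smul_eq_mul]
  push_cast
  ring

theorem contDiff_bump_sq : ContDiff ℝ 1 fun z : E => bump z ^ 2 :=
  contDiff_one_iff_hasFDerivAt.2
    ⟨_, (continuous_bump.const_mul 4).neg.smul (innerSL ℝ).continuous, hasFDerivAt_bump_sq⟩

theorem integral_bump_sq_mul_laplacian [FiniteDimensional ℝ E] [MeasurableSpace E] [BorelSpace E]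
    {v : E → ℝ} (hv : ContDiff ℝ 2 v) :
    ∫ z, bump z ^ 2 * Δ v z = 4 * ∫ z, bump z * fderiv ℝ v z z := by
  let b := stdOrthonormalBasis ℝ E
  have hs : HasCompactSupport fun z : E => bump z ^ 2 :=
    hasCompactSupport_bump.comp_left (g := (· ^ 2)) (by simp)
  have sum_inner_mul_fderiv (z : E) :
      ∑ i, inner ℝ z (b i) * fderiv ℝ v z (b i) = fderiv ℝ v z z := by
    simpa [real_inner_comm] using congrArg (fderiv ℝ v z) (b.sum_repr' z)
  rw [integral_mul_laplacian hv contDiff_bump_sq hs b, ← integral_const_mul, ← integral_neg]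
  congr with z
  rw [(hasFDerivAt_bump_sq z).fderiv, ← sum_inner_mul_fderiv, Finset.mul_sum, Finset.mul_sum,
    ← Finset.sum_neg_distrib]
  refine Finset.sum_congr rfl fun i _ => ?_
  simp only [smul_apply, innerSL_apply_apply, smul_eq_mul]
  ring

end Bump

section BallAverage

variable {E : Type*} [NormedAddCommGroup E] [InnerProductSpace ℝ E] [FiniteDimensional ℝ E]
  [MeasurableSpace E] [BorelSpace E]

/-- The (unnormalised) average of `u` over the ball of radius `t` about `y`, with weight `bump`. -/
noncomputable def ballAverage (u : E → ℝ) (y : E) (t : ℝ) : ℝ :=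
  ∫ z, bump z * u (y + t • z)

theorem integrable_bump_mul {u : E → ℝ} (hu : Continuous u) : Integrable fun z => bump z * u z :=
  (continuous_bump.mul hu).integrable_of_hasCompactSupport hasCompactSupport_bump.mul_right

theorem hasDerivAt_ballAverage_fderiv {u : E → ℝ} (hu : ContDiff ℝ 1 u) (y : E) (t : ℝ) :
    HasDerivAt (ballAverage u y) (∫ z, bump z * fderiv ℝ u (y + t • z) z) t := by
  have hcont (s : ℝ) : Continuous fun z => u (y + s • z) := hu.continuous.comp (by fun_prop)
  have hcont' : Continuous fun p : ℝ × E => fderiv ℝ u (y + p.1 • p.2) p.2 :=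
    ((hu.continuous_fderiv (by norm_num)).comp (by fun_prop)).clm_apply continuous_snd
  have integrable_deriv : Integrable fun z => bump z * fderiv ℝ u (y + t • z) z :=
    integrable_bump_mul (hcont'.comp (by fun_prop : Continuous fun z : E => (t, z)))
  obtain ⟨C, hC⟩ := ((isCompact_closedBall t 1).prod
    (isCompact_closedBall (0 : E) 1)).exists_bound_of_continuousOn hcont'.continuousOn
  refine (hasDerivAt_integral_of_dominated_loc_of_deriv_le (bound := fun z => bump z * C)
    (F := fun s z => bump z * u (y + s • z)) (F' := fun s z => bump z * fderiv ℝ u (y + s • z) z)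
    (Metric.ball_mem_nhds t one_pos)
    (Eventually.of_forall fun s => (integrable_bump_mul (hcont s)).aestronglyMeasurable)
    (integrable_bump_mul (hcont t)) integrable_deriv.aestronglyMeasurable ?_
    (integrable_bump_mul continuous_const) ?_).2
  · refine Eventually.of_forall fun z s hs => ?_
    rw [norm_mul, Real.norm_of_nonneg (bump_nonneg z)]
    rcases le_total 1 ‖z‖ with hz | hz
    · simp [bump_eq_zero hz]
    · exact mul_le_mul_of_nonneg_left
        (hC (s, z) ⟨ball_subset_closedBall hs, by simpa using hz⟩) (bump_nonneg z)
  · refine Eventually.of_forall fun z s _ => ?_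
    have hline : HasDerivAt (fun s : ℝ => y + s • z) z s := by
      simpa using ((hasDerivAt_id s).smul_const z).const_add y
    exact ((hu.differentiable (by norm_num) _).hasFDerivAt.comp_hasDerivAt s hline).const_mul _

theorem hasDerivAt_ballAverage {u : E → ℝ} (hu : ContDiff ℝ 2 u) (y : E) {t : ℝ} (ht : t ≠ 0) :
    HasDerivAt (ballAverage u y) (t / 4 * ∫ z, bump z ^ 2 * Δ u (y + t • z)) t := by
  have hdil : ContDiff ℝ 2 fun z => u (y + t • z) := hu.comp (by fun_prop)
  have key := integral_bump_sq_mul_laplacian hdil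
  simp only [laplacian_comp_add_smul hu, fderiv_comp_add_smul_apply,
    mul_left_comm _ (t ^ 2), mul_left_comm _ t, integral_const_mul] at key
  convert hasDerivAt_ballAverage_fderiv (hu.of_le (by norm_num)) y t using 1
  apply mul_left_cancel₀ ht
  linear_combination key / 4

theorem ballAverage_const (c : ℝ) (y : E) (t : ℝ) :
    ballAverage (fun _ => c) y t = c * ∫ z : E, bump z := by
  rw [ballAverage, integral_mul_const, mul_comm]

theorem ballAverage_le_add {u v : E → ℝ} (hu : Continuous u) (hv : Continuous v) {y : E} {c t : ℝ}
    (ht : 0 ≤ t) (h : ∀ x ∈ closedBall y t, u x ≤ v x + c) :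
    ballAverage u y t ≤ ballAverage v y t + c * ∫ z : E, bump z := by
  have integrable_u : Integrable fun z => bump z * u (y + t • z) :=
    integrable_bump_mul (hu.comp (by fun_prop))
  have integrable_v : Integrable fun z => bump z * v (y + t • z) :=
    integrable_bump_mul (hv.comp (by fun_prop))
  have integrable_c : Integrable fun z : E => bump z * c := integrable_bump_mul continuous_const
  rw [← ballAverage_const c y t, ballAverage, ballAverage, ballAverage,
    ← integral_add integrable_v integrable_c]
  refine integral_mono integrable_u (integrable_v.add integrable_c) fun z => ?_
  rcases le_total 1 ‖z‖ with hz | hz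
  · simp [bump_eq_zero hz]
  · simpa only [mul_add] using
      mul_le_mul_of_nonneg_left (h _ (add_smul_mem_closedBall ht hz)) (bump_nonneg z)

end BallAverage

section Supersolution

variable {E : Type*} [NormedAddCommGroup E] [InnerProductSpace ℝ E] [FiniteDimensional ℝ E]
  [MeasurableSpace E] [BorelSpace E]

/-- `-Δf + μf ≥ 0` in the sense of distributions, for a measure `μ` as the potential. -/
def IsSupersolution (μ : Measure E) (f : E → ℝ) : Prop :=
  ∀ φ : E → ℝ, ContDiff ℝ ∞ φ → HasCompactSupport φ → (∀ x, 0 ≤ φ x) →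
    ∫ x, f x * Δ φ x ≤ ∫ x, f x * φ x ∂μ

/-- The mollification of `f` by the normalised bump function `ρ`. -/
noncomputable def mollify (ρ : ContDiffBump (0 : E)) (f : E → ℝ) : E → ℝ :=
  f ⋆[ContinuousLinearMap.mul ℝ ℝ, volume] ρ.normed volume

variable {μ : Measure E} {f : E → ℝ} {ρ : ContDiffBump (0 : E)} {x y : E}

theorem normed_sub_eq_zero {z : E} (hz : z ∉ ball x ρ.rOut) : ρ.normed volume (x - z) = 0 := by
  rw [← Function.notMem_support, ρ.support_normed_eq]
  simpa [dist_eq_norm, norm_sub_rev] using hz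

theorem IsSupersolution.const_mul (hsup : IsSupersolution μ f) {c : ℝ} (hc : 0 ≤ c) :
    IsSupersolution μ fun x => c * f x := by
  intro φ hφ hs h0
  simp only [mul_assoc, integral_const_mul]
  exact mul_le_mul_of_nonneg_left (hsup φ hφ hs h0) hc

theorem contDiff_mollify (hf : Continuous f) {n : ℕ∞} : ContDiff ℝ n (mollify ρ f) :=
  ρ.hasCompactSupport_normed.contDiff_convolution_right _ hf.locallyIntegrable ρ.contDiff_normed

theorem mollify_nonneg (hf0 : ∀ x, 0 ≤ f x) (x : E) : 0 ≤ mollify ρ f x :=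
  integral_nonneg fun z => mul_nonneg (hf0 z) (ρ.nonneg_normed _)

theorem contDiff_log_one_add_mollify (hf : Continuous f) (hf0 : ∀ x, 0 ≤ f x) :
    ContDiff ℝ 2 fun x => Real.log (1 + mollify ρ f x) :=
  (contDiff_const.add (contDiff_mollify hf (n := 2))).log fun x =>
    (add_pos_of_pos_of_nonneg one_pos (mollify_nonneg hf0 x)).ne'

theorem dist_mollify_le (hf : Continuous f) {ε : ℝ}
    (hosc : ∀ z ∈ ball x ρ.rOut, dist (f z) (f x) ≤ ε) : dist (mollify ρ f x) (f x) ≤ ε := by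
  have hswap : mollify ρ f x = (ρ.normed volume ⋆[ContinuousLinearMap.lsmul ℝ ℝ, volume] f) x := by
    rw [convolution_lsmul_swap]
    simp [mollify, convolution_def, mul_comm]
  rw [hswap]
  exact ContDiffBump.dist_normed_convolution_le hf.aestronglyMeasurable hosc

theorem IsSupersolution.laplacian_mollify_le (hsup : IsSupersolution μ f) (hf : Continuous f)
    (ρ : ContDiffBump (0 : E)) (x : E) :
    Δ (mollify ρ f) x ≤ ∫ z, f z * ρ.normed volume (x - z) ∂μ := by
  rw [mollify, laplacian_convolution hf.locallyIntegrable ρ.contDiff_normed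
    ρ.hasCompactSupport_normed, convolution_def]
  have reflect (z : E) :
      Δ (fun z => ρ.normed volume (x - z)) z = Δ (ρ.normed volume) (x - z) := by
    simpa [sub_eq_add_neg] using
      laplacian_comp_add_smul (u := ρ.normed volume) ρ.contDiff_normed x (-1) z
  simpa only [reflect, ContinuousLinearMap.mul_apply'] using
    hsup (fun z => ρ.normed volume (x - z)) (ρ.contDiff_normed.comp (by fun_prop))
      (ρ.hasCompactSupport_normed.comp_homeomorph (Homeomorph.subLeft x))
      fun z => ρ.nonneg_normed _

theorem IsSupersolution.laplacian_log_one_add_mollify_le [IsLocallyFiniteMeasure μ]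
    (hsup : IsSupersolution μ f) (hf : Continuous f) (hf0 : ∀ x, 0 ≤ f x)
    (hosc : ∀ z ∈ ball x ρ.rOut, dist (f z) (f x) ≤ 1 / 2) :
    Δ (fun x => Real.log (1 + mollify ρ f x)) x ≤ ∫ z, ρ.normed volume (x - z) ∂μ := by
  set w : E → ℝ := fun x => 1 + mollify ρ f x
  have hw : ContDiff ℝ 2 w := contDiff_const.add (contDiff_mollify hf)
  have hw1 (z : E) : 1 ≤ w z := le_add_of_nonneg_right (mollify_nonneg hf0 z)
  have hpos (z : E) : 0 < w z := one_pos.trans_le (hw1 z)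
  have hΔ : Δ w x = Δ (mollify ρ f) x := by
    change Δ ((fun _ => 1 : E → ℝ) + mollify ρ f) x = _
    simpa using (contDiff_const (c := (1 : ℝ))).contDiffAt.laplacian_add
      (contDiff_mollify (ρ := ρ) hf (n := 2)).contDiffAt (x := x)
  have f_le {z : E} (hz : z ∈ ball x ρ.rOut) : f z ≤ w x := by
    have h1 := (abs_le.1 (hosc z hz)).2
    have h2 := (abs_le.1 (dist_mollify_le hf hosc)).1
    simp only [w]
    linarith
  have integrable_normed_mul {g : E → ℝ} (hg : Continuous g) :
      Integrable (fun z => g z * ρ.normed volume (x - z)) μ :=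
    (hg.mul (ρ.continuous_normed.comp (by fun_prop))).integrable_of_hasCompactSupport
      (ρ.hasCompactSupport_normed.comp_homeomorph (Homeomorph.subLeft x)).mul_left
  calc Δ (fun x => Real.log (w x)) x ≤ Δ w x / w x := laplacian_log_le hw hpos x
    _ ≤ (∫ z, w x * ρ.normed volume (x - z) ∂μ) / w x := by
      gcongr
      · exact (hpos x).le
      rw [hΔ]
      refine (hsup.laplacian_mollify_le hf ρ x).trans ?_
      refine integral_mono (integrable_normed_mul hf) (integrable_normed_mul continuous_const)
        fun z => ?_
      by_cases hz : z ∈ ball x ρ.rOut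
      · exact mul_le_mul_of_nonneg_right (f_le hz) (ρ.nonneg_normed _)
      · simp [normed_sub_eq_zero hz]
    _ = ∫ z, ρ.normed volume (x - z) ∂μ := by
      rw [integral_const_mul, mul_div_cancel_left₀ _ (hpos x).ne']

theorem bump_sq_mul_normed_eq_zero {t : ℝ} (ht : 0 ≤ t) (hx : x ∉ closedBall y (t + ρ.rOut))
    (z : E) : bump z ^ 2 * ρ.normed volume (y + t • z - x) = 0 := by
  rcases le_total 1 ‖z‖ with hz | hz
  · simp [bump_eq_zero hz]
  · rw [normed_sub_eq_zero, mul_zero]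
    contrapose! hx
    have dist_le := mem_closedBall.1 (add_smul_mem_closedBall (y := y) ht hz)
    exact mem_closedBall.2 <| (dist_triangle x (y + t • z) y).trans <| by
      linarith [mem_ball'.1 hx, dist_comm x (y + t • z)]

theorem integrable_bump_sq_mul_normed [IsLocallyFiniteMeasure μ] (ρ : ContDiffBump (0 : E)) (y : E)
    {t : ℝ} (ht : 0 ≤ t) :
    Integrable (fun p : E × E => bump p.1 ^ 2 * ρ.normed volume (y + t • p.1 - p.2))
      (volume.prod μ) := by
  have hcont : Continuous fun p : E × E => bump p.1 ^ 2 * ρ.normed volume (y + t • p.1 - p.2) :=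
    ((continuous_bump.comp continuous_fst).pow 2).mul (ρ.continuous_normed.comp (by fun_prop))
  refine hcont.integrable_of_hasCompactSupport (HasCompactSupport.intro
    ((isCompact_closedBall 0 1).prod (isCompact_closedBall y (t + ρ.rOut))) fun p hp => ?_)
  rcases le_total 1 ‖p.1‖ with hz | hz
  · simp [bump_eq_zero hz]
  · exact bump_sq_mul_normed_eq_zero ht (fun hx => hp ⟨by simpa using hz, hx⟩) p.1

theorem integral_normed_add_smul_sub {t : ℝ} (ht : 0 ≤ t) (x y : E) :
    ∫ z, ρ.normed volume (y + t • z - x) = (t ^ Module.finrank ℝ E)⁻¹ := by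
  rw [Measure.integral_comp_smul_of_nonneg volume (fun z => ρ.normed volume (y + z - x)) t
      (hR := ht),
    integral_add_left_eq_self (fun z => ρ.normed volume (z - x)), integral_sub_right_eq_self,
    ρ.integral_normed, smul_eq_mul, mul_one]

theorem integral_bump_sq_mul_normed_le {t : ℝ} (ht : 0 < t) (hρ : ρ.rOut ≤ t) (x y : E) :
    ∫ z, bump z ^ 2 * ρ.normed volume (y + t • z - x) ≤
      (closedBall y (2 * t)).indicator (fun _ => (t ^ Module.finrank ℝ E)⁻¹) x := by
  by_cases hx : x ∈ closedBall y (2 * t)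
  · rw [Set.indicator_of_mem hx, ← integral_normed_add_smul_sub (ρ := ρ) ht.le x y]
    refine integral_mono_of_nonneg
      (Eventually.of_forall fun z => mul_nonneg (sq_nonneg _) (ρ.nonneg_normed _)) ?_
      (Eventually.of_forall fun z => mul_le_of_le_one_left (ρ.nonneg_normed _)
        (pow_le_one₀ (bump_nonneg z) (bump_le_one z)))
    have integrable_translate : Integrable fun z => ρ.normed volume (y + z - x) :=
      (ρ.integrable_normed.comp_sub_right x).comp_add_left y
    exact integrable_translate.comp_smul ht.ne'
  · have vanish (z : E) : bump z ^ 2 * ρ.normed volume (y + t • z - x) = 0 :=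
      bump_sq_mul_normed_eq_zero ht.le
        (fun h => hx (closedBall_subset_closedBall (by linarith) h)) z
    simp [vanish, hx]

theorem integral_bump_sq_mul_integral_normed_le [IsLocallyFiniteMeasure μ] (y : E) {t : ℝ}
    (ht : 0 < t) (hρ : ρ.rOut ≤ t) :
    ∫ z, bump z ^ 2 * ∫ x, ρ.normed volume (y + t • z - x) ∂μ ≤
      (t ^ Module.finrank ℝ E)⁻¹ * μ.real (closedBall y (2 * t)) := by
  calc ∫ z, bump z ^ 2 * ∫ x, ρ.normed volume (y + t • z - x) ∂μ
      = ∫ z, ∫ x, bump z ^ 2 * ρ.normed volume (y + t • z - x) ∂μ := by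
        simp only [integral_const_mul]
    _ = ∫ x, (∫ z, bump z ^ 2 * ρ.normed volume (y + t • z - x)) ∂μ :=
        integral_integral_swap (integrable_bump_sq_mul_normed ρ y ht.le)
    _ ≤ ∫ x, (closedBall y (2 * t)).indicator (fun _ => (t ^ Module.finrank ℝ E)⁻¹) x ∂μ := by
        refine integral_mono_of_nonneg
          (Eventually.of_forall fun x => integral_nonneg fun z => ?_) ?_
          (Eventually.of_forall fun x => integral_bump_sq_mul_normed_le ht hρ x y)
        · exact mul_nonneg (sq_nonneg _) (ρ.nonneg_normed _)
        · exact (integrable_indicator_iff measurableSet_closedBall).2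
            (integrableOn_const measure_closedBall_lt_top.ne)
    _ = (t ^ Module.finrank ℝ E)⁻¹ * μ.real (closedBall y (2 * t)) := by
        rw [integral_indicator_const _ measurableSet_closedBall, smul_eq_mul, mul_comm]

theorem IsSupersolution.integral_bump_sq_mul_laplacian_log_le [IsLocallyFiniteMeasure μ]
    (hsup : IsSupersolution μ f) (hf : Continuous f) (hf0 : ∀ x, 0 ≤ f x) {t : ℝ} (ht : 0 < t)
    (hρ : ρ.rOut ≤ t)
    (hosc : ∀ x ∈ closedBall y t, ∀ z ∈ ball x ρ.rOut, dist (f z) (f x) ≤ 1 / 2) :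
    ∫ z, bump z ^ 2 * Δ (fun x => Real.log (1 + mollify ρ f x)) (y + t • z) ≤
      (t ^ Module.finrank ℝ E)⁻¹ * μ.real (closedBall y (2 * t)) := by
  set u : E → ℝ := fun x => Real.log (1 + mollify ρ f x)
  have hΔu : Continuous (Δ u) := continuous_laplacian (contDiff_log_one_add_mollify hf hf0)
  have hs : HasCompactSupport fun z : E => bump z ^ 2 :=
    hasCompactSupport_bump.comp_left (g := (· ^ 2)) (by simp)
  have integrable_left : Integrable fun z => bump z ^ 2 * Δ u (y + t • z) :=
    ((continuous_bump.pow 2).mul (hΔu.comp (by fun_prop))).integrable_of_hasCompactSupport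
      hs.mul_right
  have integrable_right :
      Integrable fun z => bump z ^ 2 * ∫ x, ρ.normed volume (y + t • z - x) ∂μ := by
    simpa only [integral_const_mul] using
      (integrable_bump_sq_mul_normed (μ := μ) ρ y ht.le).integral_prod_left
  refine (integral_mono integrable_left integrable_right fun z => ?_).trans
    (integral_bump_sq_mul_integral_normed_le y ht hρ)
  rcases le_total 1 ‖z‖ with hz | hz
  · simp [bump_eq_zero hz]
  · exact mul_le_mul_of_nonneg_left (hsup.laplacian_log_one_add_mollify_le hf hf0
      (hosc _ (add_smul_mem_closedBall ht.le hz))) (sq_nonneg _)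

end Supersolution

section Kato

variable {E : Type*} [NormedAddCommGroup E] [InnerProductSpace ℝ E] [MeasurableSpace E]

/-- The density `μ(B(y, t)) / t ^ (d - 1)`, `d = dim E`, whose integrability at `t = 0` expresses
the Kato condition at `y` in polar coordinates. It is written without `d - 1`, a truncated
subtraction. -/
noncomputable def katoDensity (μ : Measure E) (y : E) (t : ℝ) : ℝ :=
  t * (t ^ Module.finrank ℝ E)⁻¹ * μ.real (closedBall y t)

/-- The Kato condition at `y` in radial form; for `d ≥ 3` it is implied by the integrability of
`|x - y| ^ (2 - d)` over a ball about `y`. -/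
def IsKatoAt (μ : Measure E) (y : E) : Prop :=
  ∃ R > 0, IntervalIntegrable (katoDensity μ y) volume 0 R

variable {μ : Measure E} {f : E → ℝ} {y : E}

theorem katoDensity_nonneg {t : ℝ} (ht : 0 ≤ t) : 0 ≤ katoDensity μ y t := by
  unfold katoDensity
  positivity

variable [FiniteDimensional ℝ E] [BorelSpace E]

theorem IsSupersolution.mul_integral_bump_sq_mul_laplacian_log_le [IsLocallyFiniteMeasure μ]
    (hsup : IsSupersolution μ f) (hf : Continuous f) (hf0 : ∀ x, 0 ≤ f x)
    {ρ : ContDiffBump (0 : E)} {t : ℝ} (ht : 0 < t) (hρ : ρ.rOut ≤ t)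
    (hosc : ∀ x ∈ closedBall y t, ∀ z ∈ ball x ρ.rOut, dist (f z) (f x) ≤ 1 / 2) :
    t / 4 * ∫ z, bump z ^ 2 * Δ (fun x => Real.log (1 + mollify ρ f x)) (y + t • z) ≤
      2 ^ Module.finrank ℝ E / 8 * katoDensity μ y (2 * t) := by
  calc t / 4 * ∫ z, bump z ^ 2 * Δ (fun x => Real.log (1 + mollify ρ f x)) (y + t • z)
      ≤ t / 4 * ((t ^ Module.finrank ℝ E)⁻¹ * μ.real (closedBall y (2 * t))) := by
        gcongr
        exact hsup.integral_bump_sq_mul_laplacian_log_le hf hf0 ht hρ hosc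
    _ = 2 ^ Module.finrank ℝ E / 8 * katoDensity μ y (2 * t) := by
        rw [katoDensity, mul_pow]
        field_simp
        ring

theorem IsSupersolution.ballAverage_log_one_add_mollify_le [IsLocallyFiniteMeasure μ]
    (hsup : IsSupersolution μ f) (hf : Continuous f) (hf0 : ∀ x, 0 ≤ f x)
    {ρ : ContDiffBump (0 : E)} {η r : ℝ} (hρ : ρ.rOut ≤ η) (hηr : η ≤ r)
    (hosc : ∀ x ∈ closedBall y r, ∀ z ∈ ball x ρ.rOut, dist (f z) (f x) ≤ 1 / 2)
    (hK : IntervalIntegrable (fun t => katoDensity μ y (2 * t)) volume 0 r) :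
    ballAverage (fun x => Real.log (1 + mollify ρ f x)) y r ≤
      ballAverage (fun x => Real.log (1 + mollify ρ f x)) y η +
        2 ^ Module.finrank ℝ E / 8 * ∫ t in (0)..r, katoDensity μ y (2 * t) := by
  set u : E → ℝ := fun x => Real.log (1 + mollify ρ f x)
  have hη : 0 < η := ρ.rOut_pos.trans_le hρ
  have hu : ContDiff ℝ 2 u := contDiff_log_one_add_mollify hf hf0
  have hderiv {t : ℝ} (ht : 0 < t) := hasDerivAt_ballAverage hu y ht.ne'
  have hKη : IntervalIntegrable (fun t => katoDensity μ y (2 * t)) volume η r :=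
    hK.mono_set (Set.uIcc_subset_uIcc_right ⟨by simp [hη.le, hη.le.trans hηr], by simp [hηr]⟩)
  have increment_le := intervalIntegral.sub_le_integral_of_hasDeriv_right_of_le hηr
    (fun t ht => (hderiv (hη.trans_le ht.1)).continuousAt.continuousWithinAt)
    (fun t ht => (hderiv (hη.trans ht.1)).hasDerivWithinAt)
    ((intervalIntegrable_iff_integrableOn_Icc_of_le hηr).1 (hKη.const_mul _))
    (fun t ht => hsup.mul_integral_bump_sq_mul_laplacian_log_le hf hf0 (hη.trans ht.1)
      (hρ.trans ht.1.le) fun x hx => hosc x (closedBall_subset_closedBall ht.2.le hx))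
  rw [intervalIntegral.integral_const_mul] at increment_le
  have integral_le :
      ∫ t in η..r, katoDensity μ y (2 * t) ≤ ∫ t in (0)..r, katoDensity μ y (2 * t) :=
    intervalIntegral.integral_mono_interval hη.le hηr le_rfl
      (ae_restrict_of_forall_mem measurableSet_Ioc fun t ht =>
        katoDensity_nonneg (by linarith [ht.1])) hK
  calc ballAverage u y r
      ≤ ballAverage u y η +
          2 ^ Module.finrank ℝ E / 8 * ∫ t in η..r, katoDensity μ y (2 * t) := by
        linarith
    _ ≤ _ := by gcongr

theorem IsSupersolution.ballAverage_log_one_add_le [IsLocallyFiniteMeasure μ]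
    (hsup : IsSupersolution μ f) (hf : Continuous f) (hf0 : ∀ x, 0 ≤ f x) {r : ℝ} (hr : 0 < r)
    (hK : IntervalIntegrable (fun t => katoDensity μ y (2 * t)) volume 0 r) :
    ballAverage (fun x => Real.log (1 + f x)) y r ≤
      (Real.log (1 + f y) + 2) * (∫ z : E, bump z) +
        2 ^ Module.finrank ℝ E / 8 * ∫ t in (0)..r, katoDensity μ y (2 * t) := by
  have hlog : Continuous fun x => Real.log (1 + f x) :=
    (continuous_const.add hf).log fun x => (add_pos_of_pos_of_nonneg one_pos (hf0 x)).ne'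
  obtain ⟨η₀, hη₀, hclose⟩ := Metric.continuousAt_iff.1 (hlog.continuousAt (x := y)) 1 one_pos
  set η := min (η₀ / 2) r
  have hη : 0 < η := lt_min (half_pos hη₀) hr
  obtain ⟨ρ, hρη, hosc⟩ := exists_contDiffBump_dist_le hf y r hη one_half_pos
  have hu := (contDiff_log_one_add_mollify (ρ := ρ) hf hf0).continuous
  have mollify_close {x : E} (hx : x ∈ closedBall y r) :
      |Real.log (1 + mollify ρ f x) - Real.log (1 + f x)| ≤ 1 / 2 :=
    (abs_log_sub_log_le (by linarith [mollify_nonneg (ρ := ρ) hf0 x]) (by linarith [hf0 x])).trans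
      (by simpa [Real.dist_eq] using dist_mollify_le hf (hosc x hx))
  have start_le : ballAverage (fun x => Real.log (1 + mollify ρ f x)) y η ≤
      ballAverage (fun _ => Real.log (1 + f y)) y η + 3 / 2 * ∫ z : E, bump z := by
    refine ballAverage_le_add hu continuous_const hη.le fun x hx => ?_
    have hx₀ : dist x y < η₀ := by
      linarith [mem_closedBall.1 hx, min_le_left (η₀ / 2) r, half_lt_self hη₀]
    have h1 := (abs_lt.1 (Real.dist_eq _ _ ▸ hclose hx₀)).2
    have h2 := (abs_le.1 (mollify_close (closedBall_subset_closedBall (min_le_right _ _) hx))).2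
    linarith
  have end_le : ballAverage (fun x => Real.log (1 + f x)) y r ≤
      ballAverage (fun x => Real.log (1 + mollify ρ f x)) y r + 1 / 2 * ∫ z : E, bump z :=
    ballAverage_le_add hlog hu hr.le fun x hx => by linarith [(abs_le.1 (mollify_close hx)).1]
  rw [ballAverage_const] at start_le
  linarith [hsup.ballAverage_log_one_add_mollify_le hf hf0 hρη (min_le_right _ _) hosc hK]

theorem IsSupersolution.ballAverage_min_one_le_zero [IsLocallyFiniteMeasure μ]
    (hsup : IsSupersolution μ f) (hf : Continuous f) (hf0 : ∀ x, 0 ≤ f x) {r : ℝ} (hr : 0 < r)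
    (hK : IntervalIntegrable (fun t => katoDensity μ y (2 * t)) volume 0 r) (hy : f y = 0) :
    ballAverage (fun x => min (f x) 1) y r ≤ 0 := by
  set A := ballAverage (fun x => min (f x) 1) y r
  set C := 2 * (∫ z : E, bump z) +
    2 ^ Module.finrank ℝ E / 8 * ∫ t in (0)..r, katoDensity μ y (2 * t)
  have log_mul_le {N : ℝ} (hN : 0 ≤ N) : Real.log (1 + N) * A ≤ C := by
    have hpos (x : E) : 0 < 1 + N * f x := add_pos_of_pos_of_nonneg one_pos (mul_nonneg hN (hf0 x))
    calc Real.log (1 + N) * A = ballAverage (fun x => Real.log (1 + N) * min (f x) 1) y r := by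
          simp only [A, ballAverage, mul_left_comm (bump _), integral_const_mul]
      _ ≤ ballAverage (fun x => Real.log (1 + N * f x)) y r + 0 * ∫ z : E, bump z :=
          ballAverage_le_add (by fun_prop) ((by fun_prop : Continuous _).log fun x => (hpos x).ne')
            hr.le fun x _ => by simpa using min_one_mul_log_one_add_le hN (hf0 x)
      _ ≤ C := by
          simpa only [hy, mul_zero, zero_mul, add_zero, Real.log_one, zero_add] using
            (hsup.const_mul hN).ballAverage_log_one_add_le (hf.const_mul N)
              (fun x => mul_nonneg hN (hf0 x)) hr hK
  by_contra! hA
  have lt_log : C / A < Real.log (1 + Real.exp (C / A)) :=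
    (Real.lt_log_iff_exp_lt (by positivity)).2 (lt_one_add _)
  exact ((div_lt_iff₀ hA).1 lt_log).not_ge (log_mul_le (Real.exp_pos _).le)

theorem eq_zero_of_ballAverage_le_zero {u : E → ℝ} (hu : Continuous u) (hu0 : ∀ x, 0 ≤ u x)
    {r : ℝ} (hr : 0 < r) (h : ballAverage u y r ≤ 0) {x : E} (hx : x ∈ ball y r) : u x = 0 := by
  have hcont : Continuous fun z => bump z * u (y + r • z) :=
    continuous_bump.mul (hu.comp (by fun_prop))
  by_contra hne
  refine h.not_gt (hcont.integral_pos_of_hasCompactSupport_nonneg_nonzero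
    hasCompactSupport_bump.mul_right (fun z => mul_nonneg (bump_nonneg z) (hu0 _))
    (x := r⁻¹ • (x - y)) (mul_ne_zero (bump_pos ?_).ne' ?_))
  · rwa [norm_smul, norm_inv, Real.norm_of_nonneg hr.le, inv_mul_lt_one₀ hr, ← dist_eq_norm]
  · rwa [smul_inv_smul₀ hr.ne', add_sub_cancel]

theorem IsSupersolution.eventually_eq_zero [IsLocallyFiniteMeasure μ]
    (hsup : IsSupersolution μ f) (hf : Continuous f) (hf0 : ∀ x, 0 ≤ f x) (hμ : IsKatoAt μ y)
    (hy : f y = 0) : ∀ᶠ x in 𝓝 y, f x = 0 := by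
  obtain ⟨R, hR, hK⟩ := hμ
  have hK₂ : IntervalIntegrable (fun t => katoDensity μ y (2 * t)) volume 0 (R / 2) := by
    simpa using hK.comp_mul_left (c := 2)
  filter_upwards [ball_mem_nhds y (half_pos hR)] with x hx
  have min_eq_zero : min (f x) 1 = 0 :=
    eq_zero_of_ballAverage_le_zero (hf.min continuous_const)
      (fun x => le_min (hf0 x) zero_le_one) (half_pos hR)
      (hsup.ballAverage_min_one_le_zero hf hf0 (half_pos hR) hK₂ hy) hx
  exact (min_choice (f x) 1).elim (·.symm.trans min_eq_zero) fun h =>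
    absurd (h.symm.trans min_eq_zero) one_ne_zero

theorem lintegral_inv_pow_mul_measure_closedBall_le [SFinite μ] (n : ℕ) (y : E) (R : ℝ) :
    ∫⁻ t in Set.Ioo 0 R, ENNReal.ofReal (t ^ (n + 2))⁻¹ * μ (closedBall y t) ≤
      ∫⁻ x in ball y R, ‖x - y‖ₑ⁻¹ ^ (n + 1) ∂μ := by
  let k : ℝ → E → ℝ≥0∞ := fun t x => (closedBall y t).indicator
    (fun _ => ENNReal.ofReal (t ^ (n + 2))⁻¹) x
  have measurable_k : Measurable k.uncurry :=
    (by fun_prop : Measurable fun p : ℝ × E => ENNReal.ofReal (p.1 ^ (n + 2))⁻¹).indicator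
      (measurableSet_le (measurable_snd.dist measurable_const) measurable_fst)
  have k_le (x : E) : ∫⁻ t in Set.Ioo 0 R, k t x ≤
      (ball y R).indicator (fun x => ‖x - y‖ₑ⁻¹ ^ (n + 1)) x := by
    by_cases hx : x ∈ ball y R
    · calc ∫⁻ t in Set.Ioo 0 R, k t x
          ≤ ∫⁻ t, (Set.Ici (dist x y)).indicator (fun t => ENNReal.ofReal (t ^ (n + 2))⁻¹) t :=
            lintegral_mono' Measure.restrict_le_self fun t => le_rfl
        _ = ∫⁻ t in Set.Ioi (dist x y), ENNReal.ofReal (t ^ (n + 2))⁻¹ := by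
            rw [lintegral_indicator measurableSet_Ici, setLIntegral_congr Ioi_ae_eq_Ici.symm]
        _ ≤ (ENNReal.ofReal (dist x y))⁻¹ ^ (n + 1) := lintegral_Ioi_inv_pow_le n dist_nonneg
        _ = _ := by rw [Set.indicator_of_mem hx, dist_eq_norm, ofReal_norm]
    · refine (setLIntegral_eq_zero measurableSet_Ioo fun t ht => ?_).trans_le zero_le
      exact Set.indicator_of_notMem (fun hxt => hx (hxt.trans_lt ht.2)) _
  calc ∫⁻ t in Set.Ioo 0 R, ENNReal.ofReal (t ^ (n + 2))⁻¹ * μ (closedBall y t)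
      = ∫⁻ t in Set.Ioo 0 R, ∫⁻ x, k t x ∂μ := by
        simp only [k, lintegral_indicator_const measurableSet_closedBall]
    _ = ∫⁻ x, (∫⁻ t in Set.Ioo 0 R, k t x) ∂μ :=
        lintegral_lintegral_swap measurable_k.aemeasurable
    _ ≤ ∫⁻ x, (ball y R).indicator (fun x => ‖x - y‖ₑ⁻¹ ^ (n + 1)) x ∂μ := lintegral_mono k_le
    _ = ∫⁻ x in ball y R, ‖x - y‖ₑ⁻¹ ^ (n + 1) ∂μ := lintegral_indicator measurableSet_ball _

theorem isKatoAt_of_lintegral_lt_top [IsLocallyFiniteMeasure μ] {n : ℕ}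
    (hn : Module.finrank ℝ E = n + 3) {R : ℝ} (hR : 0 < R)
    (h : ∫⁻ x in ball y R, ‖x - y‖ₑ⁻¹ ^ (n + 1) ∂μ < ⊤) : IsKatoAt μ y := by
  refine ⟨R, hR, (intervalIntegrable_iff_integrableOn_Ioo_of_le hR.le).2 ⟨?_, ?_⟩⟩
  · have hmono : Monotone fun t => μ.real (closedBall y t) := fun s t hst =>
      measureReal_mono (closedBall_subset_closedBall hst) measure_closedBall_lt_top.ne
    exact (Measurable.mul (by fun_prop) hmono.measurable).aestronglyMeasurable
  · refine (lintegral_mono_ae ?_).trans_lt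
      ((lintegral_inv_pow_mul_measure_closedBall_le n y R).trans_lt h)
    refine ae_restrict_of_forall_mem measurableSet_Ioo fun t ht => ?_
    have hweight : t * (t ^ (n + 3))⁻¹ = (t ^ (n + 2))⁻¹ := by
      have := ht.1.ne'
      field_simp
      ring
    rw [katoDensity, hn, hweight, enorm_mul, Real.enorm_of_nonneg (by have := ht.1; positivity)]
    gcongr
    rw [Real.enorm_of_nonneg measureReal_nonneg, ofReal_measureReal measure_closedBall_lt_top.ne]

end Kato

section NewtonianPotential

theorem locallyIntegrable_norm_inv : LocallyIntegrable (fun x : E3 => ‖x‖⁻¹) volume :=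
  locallyIntegrable_of_norm_le_rpow (C := 1) (α := 1) (by simp) (by norm_num)
    (Eventually.of_forall fun x => by simp [Real.rpow_neg_one]) (by fun_prop)

theorem IsTest.integrable_div_norm_sub {φ : E3 → ℝ} (hφ : IsTest φ) (x : E3) :
    Integrable fun y => φ y / ‖x - y‖ := by
  simpa [ConvolutionExistsAt, div_eq_mul_inv] using
    hφ.2.convolutionExists_left (ContinuousLinearMap.mul ℝ ℝ) hφ.1.continuous
      locallyIntegrable_norm_inv x

theorem IsTest.continuous_invLaplacian {φ : E3 → ℝ} (hφ : IsTest φ) :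
    Continuous (invLaplacian φ) :=
  continuous_const.mul <|
    (hφ.2.continuous_convolution_left (ContinuousLinearMap.mul ℝ ℝ) hφ.1.continuous
      locallyIntegrable_norm_inv).congr fun x => by simp [convolution_def, div_eq_mul_inv]

theorem lintegral_enorm_div_norm_sub_le_katoNorm (h : E3 → ℝ) (x : E3) :
    ∫⁻ y, ‖h y / ‖x - y‖‖ₑ ≤ katoNorm h := by
  refine (lintegral_mono_ae ?_).trans (le_iSup (fun y => ∫⁻ x, ‖h x‖ₑ / ‖x - y‖ₑ) x)
  filter_upwards [compl_mem_ae_iff.2 (measure_singleton x)] with y hy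
  have norm_ne_zero : ‖x - y‖ ≠ 0 := norm_ne_zero_iff.2 (sub_ne_zero.2 (Ne.symm hy))
  rw [div_eq_mul_inv, enorm_mul, enorm_inv norm_ne_zero, enorm_norm, ← div_eq_mul_inv,
    enorm_sub_rev]

theorem norm_invLaplacian_le {h : E3 → ℝ} {ε : ℝ} (hε : 0 ≤ ε)
    (hh : katoNorm h ≤ ENNReal.ofReal ε) (x : E3) :
    ‖invLaplacian h x‖ ≤ (4 * Real.pi)⁻¹ * ε := by
  have norm_integral_le : ‖∫ y, h y / ‖x - y‖‖ ≤ ε := by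
    rw [← ENNReal.ofReal_le_ofReal_iff hε, ofReal_norm]
    exact (enorm_integral_le_lintegral_enorm _).trans
      ((lintegral_enorm_div_norm_sub_le_katoNorm h x).trans hh)
  rw [invLaplacian, norm_mul, norm_neg, Real.norm_of_nonneg (by positivity)]
  gcongr

theorem invLaplacian_sub {h k : E3 → ℝ} {x : E3} (hh : Integrable fun y => h y / ‖x - y‖)
    (hk : Integrable fun y => k y / ‖x - y‖) :
    invLaplacian (h - k) x = invLaplacian h x - invLaplacian k x := by
  simp only [invLaplacian, Pi.sub_apply, sub_div, integral_sub hh hk, mul_sub]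

theorem MemK0.continuous_invLaplacian {h : E3 → ℝ} (hh : MemK0 h) :
    Continuous (invLaplacian h) := by
  refine continuous_of_uniform_approx_of_continuous fun s hs => ?_
  obtain ⟨ε, hε, hεs⟩ := Metric.mem_uniformity_dist.1 hs
  have hη : 0 < 4 * Real.pi * (ε / 2) := by positivity
  obtain ⟨φ, hφ, hle⟩ := hh.2 (ENNReal.ofReal (4 * Real.pi * (ε / 2))) (by simpa using hη)
  refine ⟨invLaplacian φ, hφ.continuous_invLaplacian, fun x => hεs ?_⟩
  have integrable_sub : Integrable fun y => (h - φ) y / ‖x - y‖ :=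
    ⟨(hh.1.sub hφ.1.continuous.aestronglyMeasurable).div₀ (by fun_prop),
      ((lintegral_enorm_div_norm_sub_le_katoNorm _ x).trans hle).trans_lt ENNReal.ofReal_lt_top⟩
  have integrable_h : Integrable fun y => h y / ‖x - y‖ := by
    refine (integrable_sub.add (hφ.integrable_div_norm_sub x)).congr
      (Eventually.of_forall fun y => ?_)
    simp only [Pi.add_apply, Pi.sub_apply, ← add_div, sub_add_cancel]
  calc dist (invLaplacian h x) (invLaplacian φ x)
      = ‖invLaplacian (h - φ) x‖ := by
        rw [invLaplacian_sub integrable_h (hφ.integrable_div_norm_sub x), dist_eq_norm]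
    _ ≤ (4 * Real.pi)⁻¹ * (4 * Real.pi * (ε / 2)) := norm_invLaplacian_le hη.le hle x
    _ = ε / 2 := inv_mul_cancel_left₀ (by positivity) _
    _ < ε := half_lt_self hε

theorem MemInvLaplacianK0Loc.continuous {f : E3 → ℝ} (hf : MemInvLaplacianK0Loc f) :
    Continuous f := by
  refine continuous_iff_continuousAt.2 fun y => ?_
  obtain ⟨h, hh, hfh⟩ := hf y
  exact hh.continuous_invLaplacian.continuousAt.congr (EventuallyEq.symm hfh)

end NewtonianPotential

theorem IsDistribSolution.isSupersolution {V : Potential} {f : E3 → ℝ} {g : Measure E3}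
    (h : IsDistribSolution V f g) (hf0 : ∀ x, 0 ≤ f x) : IsSupersolution V.pos f := by
  intro φ hφ hs h0
  have equation := h φ ⟨hφ, hs⟩
  have source_nonneg : 0 ≤ ∫ x, φ x ∂g := integral_nonneg h0
  have neg_part_nonneg : 0 ≤ ∫ x, f x * φ x ∂V.neg :=
    integral_nonneg fun x => mul_nonneg (hf0 x) (h0 x)
  unfold Potential.integral at equation
  linarith

theorem Potential.MemKLoc.isKatoAt_pos {V : Potential} (hV : V.MemKLoc) (y : E3) :
    IsKatoAt V.pos y := by
  have := V.finite_pos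
  obtain ⟨R, hR, hfin⟩ := hV y
  refine isKatoAt_of_lintegral_lt_top (n := 0) (by simp) hR (lt_of_le_of_lt ?_ hfin)
  simpa only [zero_add, pow_one, Potential.abs] using
    lintegral_mono' (Measure.restrict_mono_measure (Measure.le_add_right le_rfl) _) le_rfl

end StrongMax

theorem mainTheorem11_general {E : Type*} [NormedAddCommGroup E] [InnerProductSpace ℝ E]
    [FiniteDimensional ℝ E] [MeasurableSpace E] [BorelSpace E] (μ : Measure E)
    [IsLocallyFiniteMeasure μ] (hμ : ∀ y, StrongMax.IsKatoAt μ y) (f : E → ℝ) (hf : Continuous f)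
    (hf0 : ∀ x, 0 ≤ f x) (hsup : StrongMax.IsSupersolution μ f) (hne : ∃ x, f x ≠ 0) :
    ∀ x, 0 < f x := by
  have isClopen_zero : IsClopen {x | f x = 0} :=
    ⟨isClosed_eq hf continuous_const, isOpen_iff_mem_nhds.2 fun y hy =>
      hsup.eventually_eq_zero hf hf0 (hμ y) hy⟩
  refine fun x => (hf0 x).lt_of_ne' fun hx => ?_
  obtain ⟨z, hz⟩ := hne
  exact hz (Set.eq_univ_iff_forall.1 (isClopen_zero.eq_univ ⟨x, hx⟩) z)

theorem mainTheorem11 (V : StrongMax.Potential) (hV : V.MemKLoc)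
    (f : StrongMax.E3 → ℝ) (hf : StrongMax.MemInvLaplacianK0Loc f) (hf0 : ∀ x, 0 ≤ f x)
    (g : MeasureTheory.Measure StrongMax.E3) (hsol : StrongMax.SolvesBVP V f g)
    (hne : ∃ x, f x ≠ 0) :
    ∀ x, 0 < f x :=
  have := V.finite_pos
  mainTheorem11_general V.pos hV.isKatoAt_pos f hf.continuous hf0
    (hsol.2.1.isSupersolution hf0) hne
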